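/- Let $p\in(1,\infty)$, $c>0$, and let $(G,d)$ be a proper metric space which is * $p$-uniformly convex with constant $c$: any two points are joined by a (minimal, constant speed) geodesic $[0,1]\to G$, and for all $x,y,z\in G$, every geodesic $\gamma$ from $x$ to $y$ and all $t\in[0,1]$, $$d(z,\gamma(t))^p\le(1-t)\,d(z,x)^p+t\,d(z,y)^p-\tfrac c2\,t(1-t)\,d(x,y)^p;$$ * symmetric perpendicular: for all geodesics $\gamma,\gamma'$ with a common point $q$ one has $\gamma\perp_q\gamma'\iff\gamma'\perp_q\gamma$, where $\gamma\perp_q\gamma'$ means $d(u,q)\le d(u,v)$ for all $u\in\gamma$, $v\in\gamma'$. For $T\colon G\to G$ put $$\psi_T(x,y)=\tfrac c2\big(d(Tx,x)^p+d(Ty,y)^p+d(Tx,Ty)^p+d(x,y)^p-d(Tx,y)^p-d(x,Ty)^p\big).$$ $T$ is called *pointwise almost $\alpha$-firmly nonexpansive at $y$* with constant $\alpha\in(0,1)$ and violation $\epsilon\ge0$ if $$d(Tx,Ty)^p\le(1+\epsilon)\,d(x,y)^p-\tfrac{1-\alpha}{\alpha}\,\psi_T(x,y)\qquad\text{for all }x\in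 G,$$ and *almost quasi $\alpha$-firmly nonexpansive* with constant $\alpha$ and violation $\epsilon$ if $\operatorname{Fix}T\ne\emptyset$ and this holds at every $y\in\operatorname{Fix}T$ with the same $\alpha$ and $\epsilon$. **Theorem.** Let $(I,\mathcal I)$ be a measurable space with a probability measure $\eta$, and let $T_i\colon G\to G$ $(i\in I)$ be such that $(x,i)\mapsto T_ix$ is measurable (with $G$ carrying its Borel $\sigma$-algebra). Suppose that each $T_i$ is almost quasi $\alpha$-firmly nonexpansive with constant $\alpha_i\in(0,1)$ and violation $\epsilon_i\ge 0$, that $\overline\epsilon:=\sup_{i\in I}\epsilon_i<\infty$, and that for every $x\in G$ the push-forward of $\eta$ under $i\mapsto T_ix$ has finite $p$-th moments, i.e. $\int_I d(T_ix,z)^p\,\eta(di)<\infty$ for all $z\in G$. Put $\overline\alpha:=\sup_{i\in I}\alpha_i$. Then for every $x\in G$ the function $y\mapsto\int_I d(T_ix,y)^p\,\eta(di)$ has exactly one minimizer $b_p(T_i,\eta)(x)$ on $G$, and the operator $\mathscr T=b_p(T_i,\eta)\colon G\to G$ satisfies, for every $y\in\bigcap_{i\in I}\operatorname{Fix}T_i$: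 * if $\overline\alpha<1$, then $\mathscr T$ is pointwise almost $\alpha$-firmly nonexpansive at $y$ with constant $\overline\alpha$ and violation $\overline\epsilon$; * if $\overline\alpha=1$, then the same inequality holds at $y$ with $\overline\alpha=1$, that is, $d(\mathscr Tx,\mathscr Ty)^p\le(1+\overline\epsilon)\,d(x,y)^p$ for all $x\in G$. -/

import Mathlib

open MeasureTheory Set

namespace AlmostFirm

noncomputable section

/-- `γ`, restricted to `[0,1]`, is a (minimal, constant speed) geodesic from `x` to `y`. -/
def IsGeodesic {G : Type*} [MetricSpace G] (γ : ℝ → G) (x y : G) : Prop :=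
  γ 0 = x ∧ γ 1 = y ∧
    ∀ s ∈ Icc (0 : ℝ) 1, ∀ t ∈ Icc (0 : ℝ) 1, dist (γ s) (γ t) = |s - t| * dist x y

/-- Any two points are joined by a geodesic. -/
def IsGeodesicSpace (G : Type*) [MetricSpace G] : Prop :=
  ∀ x y : G, ∃ γ : ℝ → G, IsGeodesic γ x y

/-- `p`-uniform convexity with constant `c`; the point `(1 - t) x ⊕ t y` is `γ t` for a
geodesic `γ` from `x` to `y`. -/
def IsPUniformlyConvex (G : Type*) [MetricSpace G] (p c : ℝ) : Prop :=
  IsGeodesicSpace G ∧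
    ∀ (x y z : G) (γ : ℝ → G), IsGeodesic γ x y → ∀ t ∈ Icc (0 : ℝ) 1,
      dist z (γ t) ^ p ≤
        (1 - t) * dist z x ^ p + t * dist z y ^ p - c / 2 * t * (1 - t) * dist x y ^ p

/-- The trace (image) of a geodesic in `G`. -/
def IsGeodesicSegment {G : Type*} [MetricSpace G] (S : Set G) : Prop :=
  ∃ (x y : G) (γ : ℝ → G), IsGeodesic γ x y ∧ S = γ '' Icc (0 : ℝ) 1

/-- Perpendicularity `S ⊥_q S'` of two geodesics (given by their traces) through `q`. -/
def Perp {G : Type*} [MetricSpace G] (q : G) (S S' : Set G) : Prop :=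
  ∀ x ∈ S, ∀ y ∈ S', dist x q ≤ dist x y

/-- For any two geodesics with a common point `q`, perpendicularity at `q` is symmetric. -/
def IsSymmetricPerpendicular (G : Type*) [MetricSpace G] : Prop :=
  ∀ (S S' : Set G) (q : G), IsGeodesicSegment S → IsGeodesicSegment S' → q ∈ S → q ∈ S' →
    (Perp q S S' ↔ Perp q S' S)

/-- The transport discrepancy `ψ_T^{(p,c)}(x, y)`. -/
def transportDiscrepancy {G : Type*} [MetricSpace G] (p c : ℝ) (T : G → G) (x y : G) : ℝ :=
  c / 2 * (dist (T x) x ^ p + dist (T y) y ^ p + dist (T x) (T y) ^ p + dist x y ^ p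
    - dist (T x) y ^ p - dist x (T y) ^ p)

/-- `T` is pointwise almost nonexpansive at `y` on the whole space, with violation `ε`. -/
def IsPointwiseAlmostNonexpansive {G : Type*} [MetricSpace G] (p : ℝ) (T : G → G)
    (ε : ℝ) (y : G) : Prop :=
  0 ≤ ε ∧ ∀ x : G, dist (T x) (T y) ^ p ≤ (1 + ε) * dist x y ^ p

/-- `T` is pointwise almost `α`-firmly nonexpansive at `y` on the whole space, with constant `α`
and violation `ε`. -/
def IsPointwiseAlmostAlphaFirm {G : Type*} [MetricSpace G] (p c : ℝ) (T : G → G)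
    (α ε : ℝ) (y : G) : Prop :=
  0 < α ∧ α < 1 ∧ 0 ≤ ε ∧
    ∀ x : G, dist (T x) (T y) ^ p ≤
      (1 + ε) * dist x y ^ p - (1 - α) / α * transportDiscrepancy p c T x y

/-- `T` is almost quasi `α`-firmly nonexpansive on the whole space, with constant `α` and
violation `ε`: it has a fixed point, and is pointwise almost `α`-firmly nonexpansive at each of
its fixed points with the same `α` and `ε`. -/
def IsAlmostQuasiAlphaFirm {G : Type*} [MetricSpace G] (p c : ℝ) (T : G → G)
    (α ε : ℝ) : Prop :=
  (Function.fixedPoints T).Nonempty ∧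
    ∀ y ∈ Function.fixedPoints T, IsPointwiseAlmostAlphaFirm p c T α ε y

/-- The Borel probability measures on `G` with finite `p`-th moments. -/
def probMoment (G : Type*) [MetricSpace G] [MeasurableSpace G] (p : ℝ) : Set (Measure G) :=
  {ν | IsProbabilityMeasure ν ∧ ∀ x : G, Integrable (fun z => dist z x ^ p) ν}

/-- `b` is a value of `b_p(T_i, η)` at `x`, i.e. a minimizer over `y` of
`∫ d(T_i x, y)^p η(di)`. -/
def IsPBarycenterAt {G I : Type*} [MetricSpace G] [MeasurableSpace I] (p : ℝ) (T : I → G → G)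
    (η : Measure I) (x b : G) : Prop :=
  ∀ y : G, ∫ i, dist (T i x) b ^ p ∂η ≤ ∫ i, dist (T i x) y ^ p ∂η

/-- `F` is the `p`-barycenter operator `b_p(T_i, η)`. -/
def IsPBarycenterOperator {G I : Type*} [MetricSpace G] [MeasurableSpace I] (p : ℝ)
    (T : I → G → G) (η : Measure I) (F : G → G) : Prop :=
  ∀ x : G, IsPBarycenterAt p T η x (F x)

end

end AlmostFirm

/-!
At a common fixed point `y` of the `T i`, almost firmness says that `T i x` lies in a set
`{z | d(y,z)^p + k d(x,z)^p ≤ r}`. Replacing `α i` and `ε i` by their suprema only enlarges this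
set, so it may be chosen independently of `i`; by uniform convexity it is closed and geodesically
convex. By symmetric perpendicularity, projecting onto such a set does not increase the distance to
any of its points, so projecting the barycenter of points of the set does not increase the
barycentric functional. By uniqueness the barycenter already lies in the set, and this membership
is the asserted inequality.
-/

namespace AlmostFirm

section UniformlyConvexFunctions

variable {G I : Type*} [MetricSpace G] {p c : ℝ} {Φ Ψ : G → ℝ} {C : Set G}

/-- Geodesic convexity in the strong sense, which asks that every geodesic between two points
of `C`, not just one of them, stay in `C`. It is the property of the sets in which a
`p`-barycenter is located. -/
def IsGeodesicallyConvex (C : Set G) : Prop :=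
  ∀ ⦃x y : G⦄ ⦃γ : ℝ → G⦄, x ∈ C → y ∈ C → IsGeodesic γ x y → ∀ t ∈ Icc (0 : ℝ) 1, γ t ∈ C

/-- Uniform convexity of a real function along all geodesics, with the modulus `c / 2 * d ^ p`.
`IsPUniformlyConvex G p c` asks this of every `fun w ↦ dist z w ^ p`; the notion serves to pass to
sums and integrals of such powers. -/
def IsPUniformlyConvexFun (p c : ℝ) (Φ : G → ℝ) : Prop :=
  ∀ ⦃x y : G⦄ ⦃γ : ℝ → G⦄, IsGeodesic γ x y → ∀ t ∈ Icc (0 : ℝ) 1,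
    Φ (γ t) ≤ (1 - t) * Φ x + t * Φ y - c / 2 * t * (1 - t) * dist x y ^ p

theorem isGeodesicallyConvex_univ : IsGeodesicallyConvex (univ : Set G) :=
  fun _ _ _ _ _ _ _ _ => mem_univ _

theorem IsPUniformlyConvex.dist_rpow (h : IsPUniformlyConvex G p c) (z : G) :
    IsPUniformlyConvexFun p c fun w => dist z w ^ p :=
  fun x y γ hγ t ht => h.2 x y z γ hγ t ht

namespace IsPUniformlyConvexFun

theorem add {c' : ℝ} (hΦ : IsPUniformlyConvexFun p c Φ) (hΨ : IsPUniformlyConvexFun p c' Ψ) :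
    IsPUniformlyConvexFun p (c + c') fun w => Φ w + Ψ w := fun x y γ hγ t ht => by
  linear_combination hΦ hγ t ht + hΨ hγ t ht

theorem const_mul {k : ℝ} (hk : 0 ≤ k) (hΦ : IsPUniformlyConvexFun p c Φ) :
    IsPUniformlyConvexFun p (k * c) fun w => k * Φ w := fun x y γ hγ t ht => by
  linear_combination k * hΦ hγ t ht

theorem integral [MeasurableSpace I] {η : Measure I} [IsProbabilityMeasure η] {Φ : I → G → ℝ}
    (hΦ : ∀ i, IsPUniformlyConvexFun p c (Φ i)) (hint : ∀ w, Integrable (Φ · w) η) :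
    IsPUniformlyConvexFun p c fun w => ∫ i, Φ i w ∂η := fun x y γ hγ t ht => by
  have hcomb : Integrable (fun i => (1 - t) * Φ i x + t * Φ i y) η :=
    ((hint x).const_mul _).add ((hint y).const_mul _)
  calc ∫ i, Φ i (γ t) ∂η
      ≤ ∫ i, ((1 - t) * Φ i x + t * Φ i y - c / 2 * t * (1 - t) * dist x y ^ p) ∂η :=
        integral_mono (hint _) (hcomb.sub (integrable_const _)) fun i => hΦ i hγ t ht
    _ = (1 - t) * ∫ i, Φ i x ∂η + t * ∫ i, Φ i y ∂η - c / 2 * t * (1 - t) * dist x y ^ p := by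
        rw [integral_sub hcomb (integrable_const _),
          integral_add ((hint x).const_mul _) ((hint y).const_mul _), integral_const_mul,
          integral_const_mul, integral_const, probReal_univ, one_smul]

theorem isGeodesicallyConvex_sublevel (hc : 0 ≤ c) (hΦ : IsPUniformlyConvexFun p c Φ) (r : ℝ) :
    IsGeodesicallyConvex {w | Φ w ≤ r} := fun x y γ hx hy hγ t ht => by
  have ht' : 0 ≤ 1 - t := sub_nonneg.2 ht.2
  have hmodulus : 0 ≤ c / 2 * t * (1 - t) * dist x y ^ p := by
    have := ht.1
    positivity
  calc Φ (γ t) ≤ (1 - t) * Φ x + t * Φ y := by linarith [hΦ hγ t ht]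
    _ ≤ (1 - t) * r + t * r :=
        add_le_add (mul_le_mul_of_nonneg_left hx ht') (mul_le_mul_of_nonneg_left hy ht.1)
    _ = r := by ring

theorem mul_dist_rpow_le (hgeo : IsGeodesicSpace G) (hΦ : IsPUniformlyConvexFun p c Φ)
    (hC : IsGeodesicallyConvex C) {m : ℝ} (hm : ∀ w ∈ C, m ≤ Φ w) {x y : G} (hx : x ∈ C)
    (hy : y ∈ C) : c / 4 * dist x y ^ p ≤ (Φ x - m) + (Φ y - m) := by
  obtain ⟨γ, hγ⟩ := hgeo x y
  have hhalf : (1 / 2 : ℝ) ∈ Icc (0 : ℝ) 1 := by norm_num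
  linarith [hm _ (hC hx hy hγ _ hhalf), hΦ hγ _ hhalf]

theorem eq_of_isMinOn (hc : 0 < c) (hgeo : IsGeodesicSpace G) (hΦ : IsPUniformlyConvexFun p c Φ)
    (hC : IsGeodesicallyConvex C) {x y : G} (hx : x ∈ C) (hy : y ∈ C) (hxmin : IsMinOn Φ C x)
    (hymin : IsMinOn Φ C y) : x = y := by
  by_contra hne
  have hle := hΦ.mul_dist_rpow_le hgeo hC (isMinOn_iff.1 hxmin) hx hy
  have hpos : 0 < c / 4 * dist x y ^ p :=
    mul_pos (by positivity) (Real.rpow_pos_of_pos (dist_pos.2 hne) p)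
  linarith [isMinOn_iff.1 hymin x hx]

theorem cauchySeq_of_tendsto_sInf (hp : 0 < p) (hc : 0 < c) (hgeo : IsGeodesicSpace G)
    (hΦ : IsPUniformlyConvexFun p c Φ) (hC : IsGeodesicallyConvex C) (hbdd : BddBelow (Φ '' C))
    {u : ℕ → G} (huC : ∀ n, u n ∈ C) (hanti : Antitone (Φ ∘ u))
    (hlim : Filter.Tendsto (Φ ∘ u) Filter.atTop (nhds (sInf (Φ '' C)))) : CauchySeq u := by
  set m := sInf (Φ '' C)
  have hm : ∀ w ∈ C, m ≤ Φ w := fun w hw => csInf_le hbdd (mem_image_of_mem Φ hw)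
  refine cauchySeq_of_le_tendsto_0 (fun N => (8 / c * (Φ (u N) - m)) ^ p⁻¹) ?_ ?_
  · intro j k N hj hk
    rw [Real.le_rpow_inv_iff_of_pos dist_nonneg
      (mul_nonneg (by positivity) (sub_nonneg.2 (hm _ (huC N)))) hp, div_mul_eq_mul_div,
      le_div_iff₀ hc]
    have hjN : Φ (u j) ≤ Φ (u N) := hanti hj
    have hkN : Φ (u k) ≤ Φ (u N) := hanti hk
    linarith [hΦ.mul_dist_rpow_le hgeo hC hm (huC j) (huC k)]
  · simpa [Real.zero_rpow (inv_pos.2 hp).ne'] using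
      ((hlim.sub_const m).const_mul (8 / c)).rpow_const (.inr (inv_pos.2 hp).le)

theorem exists_isMinOn [CompleteSpace G] (hp : 0 < p) (hc : 0 < c) (hgeo : IsGeodesicSpace G)
    (hΦ : IsPUniformlyConvexFun p c Φ) (hlsc : LowerSemicontinuous Φ) (hCc : IsClosed C)
    (hC : IsGeodesicallyConvex C) (hne : C.Nonempty) (hbdd : BddBelow (Φ '' C)) :
    ∃ q ∈ C, IsMinOn Φ C q := by
  obtain ⟨v, hanti, hlim, hv⟩ := exists_seq_tendsto_sInf (hne.image Φ) hbdd
  choose u huC huv using hv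
  obtain rfl : Φ ∘ u = v := funext huv
  obtain ⟨q, hq⟩ := cauchySeq_tendsto_of_complete
    (hΦ.cauchySeq_of_tendsto_sInf hp hc hgeo hC hbdd huC hanti hlim)
  have hqu : ∀ N, Φ q ≤ Φ (u N) := fun N =>
    (hlsc.isClosed_preimage (Φ (u N))).mem_of_tendsto hq
      (Filter.eventually_atTop.2 ⟨N, fun _ hn => hanti hn⟩)
  exact ⟨q, hCc.mem_of_tendsto hq (.of_forall huC), fun w hw =>
    (ge_of_tendsto' hlim hqu).trans (csInf_le hbdd (mem_image_of_mem Φ hw))⟩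

end IsPUniformlyConvexFun

end UniformlyConvexFunctions

section Projection

variable {G : Type*} [MetricSpace G] {p c : ℝ} {C : Set G} {b q z : G} {γ : ℝ → G}

theorem continuous_const_dist_rpow (hp : 0 ≤ p) (z : G) : Continuous fun w => dist z w ^ p :=
  (continuous_const.dist continuous_id).rpow_const fun _ => .inr hp

theorem exists_isMinOn_dist [CompleteSpace G] (hp : 0 < p) (hc : 0 < c)
    (hconv : IsPUniformlyConvex G p c) (hCc : IsClosed C) (hC : IsGeodesicallyConvex C)
    (hne : C.Nonempty) (b : G) : ∃ q ∈ C, IsMinOn (dist b) C q := by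
  obtain ⟨q, hq, hmin⟩ := (hconv.dist_rpow b).exists_isMinOn hp hc hconv.1
    (continuous_const_dist_rpow hp.le b).lowerSemicontinuous hCc hC hne
    ⟨0, forall_mem_image.2 fun _ _ => by positivity⟩
  exact ⟨q, hq, fun v hv => (Real.rpow_le_rpow_iff dist_nonneg dist_nonneg hp).1 (hmin hv)⟩

theorem IsGeodesic.dist_add_dist (hγ : IsGeodesic γ b q) {s : ℝ} (hs : s ∈ Icc (0 : ℝ) 1) :
    dist b (γ s) + dist (γ s) q = dist b q := by
  obtain ⟨rfl, rfl, hdist⟩ := hγ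
  rw [hdist 0 (by simp) s hs, hdist s hs 1 (by simp), zero_sub, abs_neg, abs_of_nonneg hs.1,
    abs_sub_comm, abs_of_nonneg (sub_nonneg.2 hs.2)]
  ring

theorem IsGeodesic.perp_of_isMinOn (hγ : IsGeodesic γ b q) (hmin : IsMinOn (dist b) C q) :
    Perp q (γ '' Icc (0 : ℝ) 1) C := by
  rintro _ ⟨s, hs, rfl⟩ v hv
  linarith [hγ.dist_add_dist hs, isMinOn_iff.1 hmin v hv, dist_triangle b (γ s) v]

theorem dist_le_dist_of_isMinOn (hgeo : IsGeodesicSpace G) (hperp : IsSymmetricPerpendicular G)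
    (hC : IsGeodesicallyConvex C) (hq : q ∈ C) (hmin : IsMinOn (dist b) C q) (hz : z ∈ C) :
    dist z q ≤ dist z b := by
  obtain ⟨γ, hγ⟩ := hgeo b q
  obtain ⟨δ, hδ⟩ := hgeo q z
  have hδC : δ '' Icc (0 : ℝ) 1 ⊆ C := image_subset_iff.2 (hC hq hz hδ)
  have hγδ : Perp q (γ '' Icc (0 : ℝ) 1) (δ '' Icc (0 : ℝ) 1) :=
    fun x hx y hy => hγ.perp_of_isMinOn hmin x hx y (hδC hy)
  have hδγ : Perp q (δ '' Icc (0 : ℝ) 1) (γ '' Icc (0 : ℝ) 1) :=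
    (hperp _ _ q ⟨b, q, γ, hγ, rfl⟩ ⟨q, z, δ, hδ, rfl⟩ ⟨1, by simp, hγ.2.1⟩
      ⟨0, by simp, hδ.1⟩).1 hγδ
  exact hδγ z ⟨1, by simp, hδ.2.1⟩ b ⟨0, by simp, hγ.1⟩

end Projection

section Barycenter

variable {G I : Type*} [MetricSpace G] [MeasurableSpace I] {p c : ℝ} {η : Measure I} {f : I → G}
  {b y : G}

/-- The `p`-th moment of the random point `f` about `w`, as a function of `w`; its minimizers are
the `p`-barycenters of `f`. By the convention for the Bochner integral it is `0` where the moment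
is infinite. -/
noncomputable def pMoment (p : ℝ) (f : I → G) (η : Measure I) (w : G) : ℝ :=
  ∫ i, dist (f i) w ^ p ∂η

theorem pMoment_nonneg (w : G) : 0 ≤ pMoment p f η w :=
  integral_nonneg fun _ => by positivity

theorem isPBarycenterAt_iff_isMinOn {T : I → G → G} {x : G} :
    IsPBarycenterAt p T η x b ↔ IsMinOn (pMoment p (T · x) η) univ b := by
  rw [isMinOn_univ_iff]
  rfl

theorem IsPUniformlyConvex.pMoment [IsProbabilityMeasure η] (hconv : IsPUniformlyConvex G p c)
    (hf : ∀ w, Integrable (fun i => dist (f i) w ^ p) η) :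
    IsPUniformlyConvexFun p c (pMoment p f η) :=
  .integral (fun i => hconv.dist_rpow (f i)) hf

theorem dist_rpow_le_mul_add (hp : 1 ≤ p) (u v w : G) :
    dist u w ^ p ≤ 2 ^ (p - 1) * (dist u v ^ p + dist v w ^ p) :=
  (Real.rpow_le_rpow dist_nonneg (dist_triangle u v w) (by positivity)).trans
    (by exact_mod_cast NNReal.rpow_add_le_mul_rpow_add_rpow (nndist u v) (nndist v w) hp)

theorem continuous_pMoment [IsFiniteMeasure η] (hp : 1 ≤ p)
    (hf : ∀ w, Integrable (fun i => dist (f i) w ^ p) η) : Continuous (pMoment p f η) := by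
  have hp0 : 0 ≤ p := zero_le_one.trans hp
  refine continuous_iff_continuousAt.2 fun w₀ => continuousAt_of_dominated
    (bound := fun i => 2 ^ (p - 1) * (dist (f i) w₀ ^ p + 1))
    (.of_forall fun w => (hf w).aestronglyMeasurable) ?_
    (((hf w₀).add (integrable_const 1)).const_mul _)
    (.of_forall fun i => (continuous_const_dist_rpow hp0 (f i)).continuousAt)
  filter_upwards [Metric.ball_mem_nhds w₀ one_pos] with w hw
  refine .of_forall fun i => ?_
  have hw1 : dist w₀ w ^ p ≤ 1 := Real.rpow_le_one dist_nonneg (Metric.mem_ball'.1 hw).le hp0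
  calc ‖dist (f i) w ^ p‖ = dist (f i) w ^ p := Real.norm_of_nonneg (by positivity)
    _ ≤ 2 ^ (p - 1) * (dist (f i) w₀ ^ p + dist w₀ w ^ p) := dist_rpow_le_mul_add hp _ _ _
    _ ≤ 2 ^ (p - 1) * (dist (f i) w₀ ^ p + 1) := by gcongr

theorem existsUnique_isMinOn_pMoment [CompleteSpace G] [Nonempty G] [IsProbabilityMeasure η]
    (hp : 1 ≤ p) (hc : 0 < c) (hconv : IsPUniformlyConvex G p c)
    (hf : ∀ w, Integrable (fun i => dist (f i) w ^ p) η) :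
    ∃! b, IsMinOn (pMoment p f η) univ b := by
  obtain ⟨b, -, hb⟩ := (hconv.pMoment hf).exists_isMinOn (zero_lt_one.trans_le hp) hc hconv.1
    (continuous_pMoment hp hf).lowerSemicontinuous isClosed_univ isGeodesicallyConvex_univ
    univ_nonempty ⟨0, forall_mem_image.2 fun w _ => pMoment_nonneg w⟩
  exact ⟨b, hb, fun b' hb' => (hconv.pMoment hf).eq_of_isMinOn hc hconv.1
    isGeodesicallyConvex_univ (mem_univ _) (mem_univ _) hb' hb⟩

theorem mem_of_isMinOn_pMoment [CompleteSpace G] [IsProbabilityMeasure η] (hp : 0 < p)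
    (hc : 0 < c) (hconv : IsPUniformlyConvex G p c) (hperp : IsSymmetricPerpendicular G)
    (hf : ∀ w, Integrable (fun i => dist (f i) w ^ p) η) {C : Set G} (hCc : IsClosed C)
    (hC : IsGeodesicallyConvex C) (hfC : ∀ᵐ i ∂η, f i ∈ C)
    (hb : IsMinOn (pMoment p f η) univ b) : b ∈ C := by
  obtain ⟨i, hi⟩ := hfC.exists
  obtain ⟨q, hq, hmin⟩ := exists_isMinOn_dist hp hc hconv hCc hC ⟨f i, hi⟩ b
  have hqb : pMoment p f η q ≤ pMoment p f η b := by
    refine integral_mono_ae (hf q) (hf b) (hfC.mono fun i hi => ?_)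
    exact Real.rpow_le_rpow dist_nonneg (dist_le_dist_of_isMinOn hconv.1 hperp hC hq hmin hi) hp.le
  have hqmin : IsMinOn (pMoment p f η) univ q := fun w hw => hqb.trans (hb hw)
  rwa [(hconv.pMoment hf).eq_of_isMinOn hc hconv.1 isGeodesicallyConvex_univ (mem_univ b)
    (mem_univ q) hb hqmin]

theorem isMinOn_pMoment_of_ae_eq (hp : p ≠ 0) (hf : ∀ᵐ i ∂η, f i = y) :
    IsMinOn (pMoment p f η) univ y := by
  have hzero : pMoment p f η y = 0 :=
    integral_eq_zero_of_ae (hf.mono fun i hi => by simp [hi, Real.zero_rpow hp])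
  exact fun w _ => hzero.trans_le (pMoment_nonneg w)

end Barycenter

section FirmImages

variable {G : Type*} [MetricSpace G] {p c α ε : ℝ} {T : G → G} {x y : G}

/-- The points that almost `α`-firmness with violation `ε` at a fixed point `y` of `T` allows as
values of `T x`: at a fixed point the transport discrepancy reduces to `c / 2 * dist (T x) x ^ p`.
The constant `α = 1` removes the second term and gives almost nonexpansiveness. -/
def firmImages (p c α ε : ℝ) (x y : G) : Set G :=
  {z | dist y z ^ p + (1 - α) / α * (c / 2) * dist x z ^ p ≤ (1 + ε) * dist x y ^ p}

theorem isClosed_firmImages (hp : 0 ≤ p) : IsClosed (firmImages p c α ε x y) :=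
  isClosed_le ((continuous_const_dist_rpow hp y).add
    ((continuous_const_dist_rpow hp x).const_mul _)) continuous_const

theorem isGeodesicallyConvex_firmImages (hc : 0 ≤ c) (hconv : IsPUniformlyConvex G p c)
    (hα : 0 ≤ α) (hα1 : α ≤ 1) : IsGeodesicallyConvex (firmImages p c α ε x y) := by
  have hk : 0 ≤ (1 - α) / α * (c / 2) :=
    mul_nonneg (div_nonneg (sub_nonneg.2 hα1) hα) (by positivity)
  exact ((hconv.dist_rpow y).add ((hconv.dist_rpow x).const_mul hk)).isGeodesicallyConvex_sublevel
    (by positivity) _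

theorem firmImages_subset (hc : 0 ≤ c) {α' ε' : ℝ} (hα : 0 < α) (hαα' : α ≤ α') (hεε' : ε ≤ ε') :
    firmImages p c α ε x y ⊆ firmImages p c α' ε' x y := by
  intro z hz
  have hk : (1 - α') / α' ≤ (1 - α) / α := by
    rw [div_le_div_iff₀ (hα.trans_le hαα') hα]
    linarith
  calc dist y z ^ p + (1 - α') / α' * (c / 2) * dist x z ^ p
      ≤ dist y z ^ p + (1 - α) / α * (c / 2) * dist x z ^ p := by gcongr
    _ ≤ (1 + ε) * dist x y ^ p := hz
    _ ≤ (1 + ε') * dist x y ^ p := by gcongr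

theorem transportDiscrepancy_of_isFixedPt (hp : p ≠ 0) (hy : Function.IsFixedPt T y) (x : G) :
    transportDiscrepancy p c T x y = c / 2 * dist x (T x) ^ p := by
  simp only [transportDiscrepancy, hy.eq, dist_self, Real.zero_rpow hp, dist_comm (T x) x]
  ring

theorem isPointwiseAlmostAlphaFirm_iff (hp : p ≠ 0) (hy : Function.IsFixedPt T y) :
    IsPointwiseAlmostAlphaFirm p c T α ε y ↔
      0 < α ∧ α < 1 ∧ 0 ≤ ε ∧ ∀ x, T x ∈ firmImages p c α ε x y := by
  simp only [IsPointwiseAlmostAlphaFirm, transportDiscrepancy_of_isFixedPt hp hy, hy.eq,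
    firmImages, mem_ofPred_eq, le_sub_iff_add_le, mul_assoc, dist_comm _ y]

theorem isPointwiseAlmostNonexpansive_iff (hy : Function.IsFixedPt T y) :
    IsPointwiseAlmostNonexpansive p T ε y ↔ 0 ≤ ε ∧ ∀ x, T x ∈ firmImages p c 1 ε x y := by
  simp [IsPointwiseAlmostNonexpansive, hy.eq, firmImages, dist_comm _ y]

end FirmImages

section CommonFixedPoints

variable {G I : Type*} [MetricSpace G] [MeasurableSpace I] {p c : ℝ} {η : Measure I}
  [IsProbabilityMeasure η] {T : I → G → G} {b x y : G}

theorem IsPBarycenterAt.eq_of_ae_isFixedPt (hp : p ≠ 0) (hc : 0 < c)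
    (hconv : IsPUniformlyConvex G p c) (hT : ∀ w, Integrable (fun i => dist (T i y) w ^ p) η)
    (hb : IsPBarycenterAt p T η y b) (hy : ∀ᵐ i ∂η, Function.IsFixedPt (T i) y) : b = y :=
  (hconv.pMoment hT).eq_of_isMinOn hc hconv.1 isGeodesicallyConvex_univ (mem_univ b)
    (mem_univ y) (isPBarycenterAt_iff_isMinOn.1 hb) (isMinOn_pMoment_of_ae_eq hp hy)

theorem IsPBarycenterAt.mem_firmImages [CompleteSpace G] (hp : 0 < p) (hc : 0 < c)
    (hconv : IsPUniformlyConvex G p c) (hperp : IsSymmetricPerpendicular G)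
    (hT : ∀ w, Integrable (fun i => dist (T i x) w ^ p) η) (hb : IsPBarycenterAt p T η x b)
    {α ε : ℝ} (hα : 0 ≤ α) (hα1 : α ≤ 1) (hTx : ∀ᵐ i ∂η, T i x ∈ firmImages p c α ε x y) :
    b ∈ firmImages p c α ε x y :=
  mem_of_isMinOn_pMoment hp hc hconv hperp hT (isClosed_firmImages hp.le)
    (isGeodesicallyConvex_firmImages hc.le hconv hα hα1) hTx (isPBarycenterAt_iff_isMinOn.1 hb)

end CommonFixedPoints

end AlmostFirm

open AlmostFirm in
theorem theorem2p6_general {G : Type*} [MetricSpace G] [CompleteSpace G] {I : Type*}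
    [MeasurableSpace I] {p c : ℝ} (hp : 1 < p) (hc : 0 < c) (hconv : IsPUniformlyConvex G p c)
    (hperp : IsSymmetricPerpendicular G) {T : I → G → G} {α ε : I → ℝ}
    (hε : BddAbove (range ε)) {η : Measure I} [IsProbabilityMeasure η]
    (hT : ∀ x w, Integrable (fun i => dist (T i x) w ^ p) η) :
    (∀ x, ∃! b, IsPBarycenterAt p T η x b) ∧
    ∀ F, IsPBarycenterOperator p T η F → ∀ y ∈ ⋂ i, Function.fixedPoints (T i),
      (∀ i, IsPointwiseAlmostAlphaFirm p c (T i) (α i) (ε i) y) →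
        ((⨆ i, α i) < 1 → IsPointwiseAlmostAlphaFirm p c F (⨆ i, α i) (⨆ i, ε i) y) ∧
        ((⨆ i, α i) = 1 → IsPointwiseAlmostNonexpansive p F (⨆ i, ε i) y) := by
  have hp0 : 0 < p := zero_lt_one.trans hp
  refine ⟨fun x => ?_, fun F hF y hy hfirm => ?_⟩
  · have : Nonempty G := ⟨x⟩
    simpa only [isPBarycenterAt_iff_isMinOn] using
      existsUnique_isMinOn_pMoment hp.le hc hconv (hT x)
  obtain ⟨i₀⟩ := η.nonempty_of_neZero
  have hα : BddAbove (range α) := ⟨1, forall_mem_range.2 fun i => (hfirm i).2.1.le⟩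
  have hα0 : 0 < ⨆ i, α i := (hfirm i₀).1.trans_le (le_ciSup hα i₀)
  have hαle : ⨆ i, α i ≤ 1 := Real.iSup_le (fun i => (hfirm i).2.1.le) zero_le_one
  have hε0 : 0 ≤ ⨆ i, ε i := (hfirm i₀).2.2.1.trans (le_ciSup hε i₀)
  have hfix : ∀ i, Function.IsFixedPt (T i) y := fun i => mem_iInter.1 hy i
  have hFy : Function.IsFixedPt F y :=
    (hF y).eq_of_ae_isFixedPt hp0.ne' hc hconv (hT y) (.of_forall hfix)
  have hTx : ∀ x i, T i x ∈ firmImages p c (⨆ i, α i) (⨆ i, ε i) x y := fun x i =>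
    firmImages_subset hc.le (hfirm i).1 (le_ciSup hα i) (le_ciSup hε i)
      (((isPointwiseAlmostAlphaFirm_iff hp0.ne' (hfix i)).1 (hfirm i)).2.2.2 x)
  have hFx : ∀ x, F x ∈ firmImages p c (⨆ i, α i) (⨆ i, ε i) x y := fun x =>
    (hF x).mem_firmImages hp0 hc hconv hperp (hT x) hα0.le hαle (.of_forall (hTx x))
  exact ⟨fun hα1 => (isPointwiseAlmostAlphaFirm_iff hp0.ne' hFy).2 ⟨hα0, hα1, hε0, hFx⟩,
    fun hα1 => (isPointwiseAlmostNonexpansive_iff hFy).2 ⟨hε0, hα1 ▸ hFx⟩⟩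

theorem theorem2p6 {G : Type*} [MetricSpace G] [ProperSpace G] [MeasurableSpace G] [BorelSpace G]
    {I : Type*} [MeasurableSpace I] (p c : ℝ) (hp : 1 < p) (hc : 0 < c)
    (hconv : AlmostFirm.IsPUniformlyConvex G p c)
    (hperp : AlmostFirm.IsSymmetricPerpendicular G)
    (T : I → G → G) (hT : Measurable (fun q : G × I => T q.2 q.1))
    (α ε : I → ℝ) (hfirm : ∀ i, AlmostFirm.IsAlmostQuasiAlphaFirm p c (T i) (α i) (ε i))
    (hε : BddAbove (Set.range ε))
    (η : MeasureTheory.Measure I) [MeasureTheory.IsProbabilityMeasure η]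
    (hη : ∀ x : G, η.map (fun i => T i x) ∈ AlmostFirm.probMoment G p) :
    (∀ x : G, ∃! b : G, AlmostFirm.IsPBarycenterAt p T η x b) ∧
    ∀ F : G → G, AlmostFirm.IsPBarycenterOperator p T η F →
      ∀ y ∈ ⋂ i, Function.fixedPoints (T i),
        ((⨆ i, α i) < 1 →
          AlmostFirm.IsPointwiseAlmostAlphaFirm p c F (⨆ i, α i) (⨆ i, ε i) y) ∧
        ((⨆ i, α i) = 1 →
          AlmostFirm.IsPointwiseAlmostNonexpansive p F (⨆ i, ε i) y) := by
  have hint x w := ((hη x).2 w).comp_measurable (hT.comp measurable_prodMk_left)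
  exact (theorem2p6_general hp hc hconv hperp hε hint).imp_right fun h F hF y hy =>
    h F hF y hy fun i => (hfirm i).2 y (Set.mem_iInter.1 hy i)
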